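/- Let $S\subset\mathbb{R}\times\mathbb{R}_+$ (with $\mathbb{R}_+=[0,\infty)$) be compact and nonempty, and let $\mu$ be a Borel probability measure on $\mathbb{R}$ such that $\int e^{c|x|}\,d\mu(x)<\infty$ for some $c>0$. Write $\mathscr{P}(X)$ for the set of Borel probability measures on $X$. Let $\mathcal{N}(m,\sigma)$ be the Gaussian measure on $\mathbb{R}$ with mean $m$ and standard deviation $\sigma$, where $\mathcal{N}(m,0)=\delta_m$. For $\phi\in\mathscr{P}(S)$ let $\nu_\phi(B)=\int_S\mathcal{N}(m,\sigma)(B)\,d\phi(m,\sigma)$ be the Gaussian mixture with mixing measure $\phi$. For $\lambda\in\mathscr{P}(\mathbb{R}^2)$ let $\lambda_x,\lambda_y$ be its marginals, and let $W_2(\mu,\nu)^2=\inf\{\int(x-y)^2\,d\lambda:\lambda\in\mathscr{P}(\mathbb{R}^2),\ \lambda_x=\mu,\ \lambda_y=\nu\}$. Consider the optimal transport problem $$\tau=\inf_{\phi\in\mathscr{P}(S)}W_2(\mu,\nu_\phi)^2=\inf_{\phi\in\mathscr{P}(S),\,\lambda\in\mathscr{P}(\mathbb{R}^2)}\Big\{\int(x-y)^2\,d\lambda:\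 \lambda_x=\mu,\ \lambda_y=\nu_\phi\Big\}\qquad(\mathrm{OT})$$ and the moment problem $$\inf_{\phi\in\mathscr{P}(S),\,\lambda\in\mathscr{P}(\mathbb{R}^2)}\Big\{\int(x-y)^2\,d\lambda:\ \int x^j\,d\lambda=\int x^j\,d\mu,\ \ \int y^j\,d\lambda=\int_S p_j(m,\sigma)\,d\phi\ \ \text{for all } j\in\mathbb{N}\Big\},\qquad(\mathrm{M})$$ where all moments in the constraints are required to be finite and $p_j(m,\sigma)=\sum_{0\le 2k\le j}\binom{j}{2k}(2k-1)!!\,\sigma^{2k}m^{j-2k}$ (with $(-1)!!=1$) is the polynomial giving the $j$-th moment of $\mathcal{N}(m,\sigma)$. A Borel measure with all moments finite is called moment determinate if no other Borel measure has the same moments. Then $\tau<\infty$ and: (i) Problem (OT) has an optimal solution $(\phi^*,\lambda^*)\in\mathscr{P}(S)\times\mathscr{P}(\mathbb{R}^2)$, that is, $\lambda^*_x=\mu$, $\lambda^*_y=\nu_{\phi^*}$ and $\int(x-y)^2\,d\lambda^*=W_2(\mu,\nu_{\phi^*})^2=\tau$, which is also an optimal solution of (M) and for which both $\lambda^*$ and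 $\nu_{\phi^*}$ are moment determinate. (ii) For every optimal solution $(\phi^*,\lambda^*)$ of (OT), $\tau=0$ if and only if $\mu=\nu_{\phi^*}$, and also if and only if $\mu=\nu_{\phi^*}$ and $\lambda^*$ is the image of $\mu$ under $x\mapsto(x,x)$. Moreover, $\tau=0$ if and only if $\mu$ is a Gaussian mixture with parameters in $S$, i.e. $\mu=\nu_\phi$ for some $\phi\in\mathscr{P}(S)$. -/

import Mathlib

open MeasureTheory ProbabilityTheory
open scoped ENNReal

namespace GaussMix

/-- The transport cost `∫ (x - y)² dλ(x, y)`, as a value in `[0, ∞]`. -/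
noncomputable def cost (lam : ProbabilityMeasure (ℝ × ℝ)) : ℝ≥0∞ :=
  ∫⁻ z, ENNReal.ofReal ((z.1 - z.2) ^ 2) ∂(lam : Measure (ℝ × ℝ))

/-- `lam` is a coupling of `μ` and `ν`: a probability measure on the plane whose marginals
with respect to `x` and `y` are `μ` and `ν`. -/
def IsCoupling (μ ν : Measure ℝ) (lam : ProbabilityMeasure (ℝ × ℝ)) : Prop :=
  (lam : Measure (ℝ × ℝ)).map Prod.fst = μ ∧ (lam : Measure (ℝ × ℝ)).map Prod.snd = ν

/-- The `2`-Wasserstein distance on the real line: the square root of the infimum of the transport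
cost over all couplings. -/
noncomputable def W2 (μ ν : Measure ℝ) : ℝ≥0∞ :=
  (⨅ (lam : ProbabilityMeasure (ℝ × ℝ)) (_ : IsCoupling μ ν lam), cost lam) ^ (1 / 2 : ℝ)

/-- The Gaussian measure `N(m, σ)` with mean `m` and standard deviation `σ` (variance `σ²`);
for `σ = 0` it is the Dirac mass at `m`. -/
noncomputable def normal (p : ℝ × ℝ) : Measure ℝ :=
  gaussianReal p.1 (p.2 ^ 2).toNNReal

instance (p : ℝ × ℝ) : IsProbabilityMeasure (normal p) := by
  unfold normal; infer_instance

theorem measurable_normal : Measurable normal := by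
  unfold normal
  exact measurable_gaussianReal.comp
    (f := fun p : ℝ × ℝ => (p.1, (p.2 ^ 2).toNNReal)) (by fun_prop)

/-- The Gaussian mixture `ν_φ = ∫_S N(m, σ) dφ(m, σ)` with mixing measure `φ` on `S`. -/
noncomputable def mixture {S : Set (ℝ × ℝ)} (φ : ProbabilityMeasure S) : Measure ℝ :=
  (φ : Measure S).bind fun p => normal p.1

theorem mixture_apply {S : Set (ℝ × ℝ)} (φ : ProbabilityMeasure S) {B : Set ℝ}
    (hB : MeasurableSet B) : mixture φ B = ∫⁻ p, normal p.1 B ∂(φ : Measure S) :=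
  Measure.bind_apply hB (measurable_normal.comp measurable_subtype_coe).aemeasurable

instance {S : Set (ℝ × ℝ)} (φ : ProbabilityMeasure S) : IsProbabilityMeasure (mixture φ) :=
  ⟨by simp [mixture_apply φ MeasurableSet.univ]⟩

/-- The value `τ = inf_φ W₂(μ, ν_φ)²` over all probability measures `φ` on `S`. -/
noncomputable def tau (μ : Measure ℝ) (S : Set (ℝ × ℝ)) : ℝ≥0∞ :=
  ⨅ φ : ProbabilityMeasure S, W2 μ (mixture φ) ^ 2

/-- Feasibility for the optimal transport problem with free mixing measure:
the marginals of `lam` are `μ` and `ν_φ`. -/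
def FeasibleOT (μ : Measure ℝ) {S : Set (ℝ × ℝ)}
    (φ : ProbabilityMeasure S) (lam : ProbabilityMeasure (ℝ × ℝ)) : Prop :=
  IsCoupling μ (mixture φ) lam

/-- `(φ, lam)` is an optimal solution of the optimal transport problem: it is feasible and has the
least cost among all feasible pairs. -/
def OptimalOT (μ : Measure ℝ) {S : Set (ℝ × ℝ)}
    (φ : ProbabilityMeasure S) (lam : ProbabilityMeasure (ℝ × ℝ)) : Prop :=
  FeasibleOT μ φ lam ∧
    ∀ (φ' : ProbabilityMeasure S) (lam' : ProbabilityMeasure (ℝ × ℝ)),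
      FeasibleOT μ φ' lam' → cost lam ≤ cost lam'

/-- The polynomial `p_j ∈ ℝ[m, σ]` (variables `X 0 = m` and `X 1 = σ`) that gives the `j`-th moment
of `N(m, σ)`: `p_j = ∑_{2k ≤ j} (j choose 2k) (2k-1)!! σ^{2k} m^{j-2k}`, where `(-1)!! = 1`
(for `k = 0` the code reads `0!! = 1`). -/
noncomputable def momentPoly (j : ℕ) : MvPolynomial (Fin 2) ℝ :=
  ∑ k ∈ Finset.range (j / 2 + 1),
    MvPolynomial.C ((j.choose (2 * k) * (2 * k - 1).doubleFactorial : ℕ) : ℝ) *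
      MvPolynomial.X 1 ^ (2 * k) * MvPolynomial.X 0 ^ (j - 2 * k)

theorem integrable_pow_gaussian (m : ℝ) (v : NNReal) (j : ℕ) :
    Integrable (fun x : ℝ => x ^ j) (gaussianReal m v) := by
  have h := (memLp_id_gaussianReal (μ := m) (v := v) (j : NNReal))
  have h' := MemLp.integrable_norm_pow' (p := j) (by exact_mod_cast h)
  rw [← integrable_norm_iff (by fun_prop)]
  simpa using h'

theorem integral_pow_stdNormal_odd (k : ℕ) : ∫ x, x ^ (2 * k + 1) ∂gaussianReal 0 1 = 0 := by
  have h : ∫ x, x ^ (2 * k + 1) ∂((gaussianReal 0 1).map (fun x : ℝ => -x)) =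
      ∫ x, x ^ (2 * k + 1) ∂gaussianReal 0 1 := by
    rw [gaussianReal_map_neg, neg_zero]
  rw [integral_map (by fun_prop) (by fun_prop)] at h
  have h2 : ∀ x : ℝ, (-x) ^ (2 * k + 1) = -(x ^ (2 * k + 1)) := fun x =>
    Odd.neg_pow ⟨k, rfl⟩ x
  simp only [h2, integral_neg] at h
  linarith

theorem integral_pow_stdNormal_even (k : ℕ) :
    ∫ x, x ^ (2 * k) ∂gaussianReal 0 1 = ((2 * k - 1).doubleFactorial : ℝ) := by
  rw [integral_gaussianReal_eq_integral_smul one_ne_zero]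
  have h1 : ∀ x : ℝ, gaussianPDFReal 0 1 x • x ^ (2 * k) =
      (Real.sqrt (2 * Real.pi))⁻¹ *
        (fun y : ℝ => y ^ ((2 * k : ℕ) : ℝ) * Real.exp (-(1 / 2) * y ^ (2 : ℝ))) |x| := by
    intro x
    have e : |x| ^ (2 * k) = x ^ (2 * k) := by rw [pow_mul, sq_abs, ← pow_mul]
    have e2 : |x| ^ (2 : ℝ) = x ^ 2 := by
      rw [show (2 : ℝ) = ((2 : ℕ) : ℝ) by norm_num, Real.rpow_natCast, sq_abs]
    simp only [gaussianPDFReal, Real.rpow_natCast, e, e2, smul_eq_mul, NNReal.coe_one, mul_one,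
      sub_zero]
    rw [show -x ^ 2 / 2 = -(1 / 2) * x ^ 2 by ring]
    ring
  simp_rw [h1]
  rw [integral_const_mul, integral_comp_abs
      (f := fun y : ℝ => y ^ ((2 * k : ℕ) : ℝ) * Real.exp (-(1 / 2) * y ^ (2 : ℝ))),
    integral_rpow_mul_exp_neg_mul_rpow (by norm_num) (by
      have : (0 : ℝ) ≤ ((2 * k : ℕ) : ℝ) := Nat.cast_nonneg _
      linarith) (by norm_num)]
  have h3 : (((2 * k : ℕ) : ℝ) + 1) / 2 = k + 1 / 2 := by push_cast; ring
  have h4 : -(((2 * k : ℕ) : ℝ) + 1) / 2 = -(k + 1 / 2) := by push_cast; ring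
  rw [h3, Real.Gamma_nat_add_half]
  have h5 : (1 / 2 : ℝ) ^ (-(((2 * k : ℕ) : ℝ) + 1) / 2) = 2 ^ k * Real.sqrt 2 := by
    rw [h4, one_div, Real.inv_rpow (by norm_num), ← Real.rpow_neg (by norm_num), neg_neg,
      Real.rpow_add (by norm_num), Real.rpow_natCast, Real.sqrt_eq_rpow, one_div]
  rw [h5, Real.sqrt_mul (by norm_num)]
  have := Real.sqrt_ne_zero'.2 Real.pi_pos
  have h2 : Real.sqrt 2 ≠ 0 := by positivity
  field_simp

/-- `p_j(m, σ)` is the `j`-th moment of `N(m, σ)`. -/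
theorem eval_momentPoly (p : ℝ × ℝ) (j : ℕ) :
    MvPolynomial.eval ![p.1, p.2] (momentPoly j) = ∫ x, x ^ j ∂normal p := by
  have hn : normal p = (gaussianReal 0 1).map (fun z => p.2 * z + p.1) := by
    have e : (gaussianReal 0 1).map (fun z => p.2 * z + p.1) =
        ((gaussianReal 0 1).map (fun z => p.2 * z)).map (fun z => z + p.1) := by
      rw [Measure.map_map (by fun_prop) (by fun_prop)]; rfl
    rw [e, gaussianReal_map_const_mul, gaussianReal_map_add_const, normal]
    congr 1
    · simp
    · ext; simp [sq_nonneg]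
  have hint : ∀ i : ℕ, Integrable (fun x : ℝ => x ^ i) (gaussianReal 0 1) := integrable_pow_gaussian 0 1
  rw [hn, integral_map (by fun_prop) (by fun_prop)]
  simp_rw [add_pow, mul_pow]
  rw [integral_finsetSum _ fun i _ => by
    simpa [mul_assoc, mul_comm, mul_left_comm] using
      (hint i).const_mul (p.2 ^ i * (p.1 ^ (j - i) * (j.choose i : ℝ)))]
  have h1 : ∀ i, ∫ x, p.2 ^ i * x ^ i * p.1 ^ (j - i) * (j.choose i : ℝ) ∂gaussianReal 0 1 =
      p.2 ^ i * p.1 ^ (j - i) * (j.choose i : ℝ) * ∫ x, x ^ i ∂gaussianReal 0 1 := by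
    intro i
    rw [← integral_const_mul]
    congr 1; ext x; ring
  simp_rw [h1]
  simp only [momentPoly, map_sum, map_mul, map_pow, MvPolynomial.eval_C, MvPolynomial.eval_X]
  symm
  rw [← Finset.sum_subset (s₁ := (Finset.range (j / 2 + 1)).image (fun k => 2 * k))]
  · rw [Finset.sum_image (fun a _ b _ h => by simpa using h)]
    refine Finset.sum_congr rfl fun k _ => ?_
    rw [integral_pow_stdNormal_even]
    simp
    ring
  · intro i hi
    simp only [Finset.mem_image, Finset.mem_range] at hi ⊢
    omega
  · intro i hi hi'
    obtain ⟨k, rfl | rfl⟩ := Nat.even_or_odd' i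
    · exact absurd (Finset.mem_image.2 ⟨k, by simp at hi ⊢; omega, rfl⟩) hi'
    · rw [integral_pow_stdNormal_odd, mul_zero]

/-- Feasibility for the moment problem: `lam_{(j,0)} = μ_j` and `lam_{(0,j)} = ∫ p_j dφ` for all
`j`, all these moments of `lam` being finite. -/
def FeasibleMoment (μ : Measure ℝ) {S : Set (ℝ × ℝ)}
    (φ : ProbabilityMeasure S) (lam : ProbabilityMeasure (ℝ × ℝ)) : Prop :=
  ∀ j : ℕ,
    (Integrable (fun z : ℝ × ℝ => z.1 ^ j) (lam : Measure (ℝ × ℝ)) ∧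
      ∫ z, z.1 ^ j ∂(lam : Measure (ℝ × ℝ)) = ∫ x, x ^ j ∂μ) ∧
    (Integrable (fun z : ℝ × ℝ => z.2 ^ j) (lam : Measure (ℝ × ℝ)) ∧
      ∫ z, z.2 ^ j ∂(lam : Measure (ℝ × ℝ)) =
        ∫ p, MvPolynomial.eval ![p.1.1, p.1.2] (momentPoly j) ∂(φ : Measure S))

/-- `(φ, lam)` is an optimal solution of the moment problem. -/
def OptimalMoment (μ : Measure ℝ) {S : Set (ℝ × ℝ)}
    (φ : ProbabilityMeasure S) (lam : ProbabilityMeasure (ℝ × ℝ)) : Prop :=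
  FeasibleMoment μ φ lam ∧
    ∀ (φ' : ProbabilityMeasure S) (lam' : ProbabilityMeasure (ℝ × ℝ)),
      FeasibleMoment μ φ' lam' → cost lam ≤ cost lam'

/-- A Borel measure on the line is moment determinate: all its moments are finite and no other
measure has the same moments. -/
def Determinate (ν : Measure ℝ) : Prop :=
  (∀ j : ℕ, Integrable (fun x : ℝ => x ^ j) ν) ∧
    ∀ ν' : Measure ℝ,
      (∀ j : ℕ, Integrable (fun x : ℝ => x ^ j) ν' ∧ ∫ x, x ^ j ∂ν' = ∫ x, x ^ j ∂ν) → ν' = ν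

/-- A Borel measure on the plane is moment determinate: all its moments are finite and no other
measure has the same moments. -/
def Determinate₂ (ν : Measure (ℝ × ℝ)) : Prop :=
  (∀ i j : ℕ, Integrable (fun z : ℝ × ℝ => z.1 ^ i * z.2 ^ j) ν) ∧
    ∀ ν' : Measure (ℝ × ℝ),
      (∀ i j : ℕ, Integrable (fun z : ℝ × ℝ => z.1 ^ i * z.2 ^ j) ν' ∧
        ∫ z, z.1 ^ i * z.2 ^ j ∂ν' = ∫ z, z.1 ^ i * z.2 ^ j ∂ν) → ν' = ν

end GaussMix

open GaussMix

/-! Existence is the direct method. The cost is weakly lower semicontinuous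
(`lowerSemicontinuous_cost`), and the feasible pairs form a weakly compact set
(`isCompact_feasibleOT`). Indeed `φ ↦ ν_φ` is weakly continuous on the compact space of probability
measures on `S`, so the mixtures form a tight family. The other marginal is fixed, so the couplings
are tight too and Prokhorov applies. A minimizer over pairs attains both `τ` and the Wasserstein
infimum for its own mixture.

The moment problem has the same feasible set (`feasibleMoment_iff_feasibleOT`). `μ` has an
exponential moment by hypothesis and every `ν_φ` has one because `S` is bounded, so equal moments
force equal marginals. Determinacy on the line comes from analyticity of the complex moment
generating function on a strip. In the plane it follows by the Cramér–Wold device, since linear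
images of the coupling inherit exponential moments.

If `τ = 0`, an optimal coupling is concentrated on the diagonal, so its marginals agree. Conversely
the diagonal coupling of a mixture with itself costs nothing. -/

namespace GaussMix

open scoped Topology

/-! ### Moment determinacy under an exponential moment -/

/-- Some exponential moment `∫ exp (c |x|) dν`, `c > 0`, is finite. -/
def HasExpMoment (ν : Measure ℝ) : Prop :=
  ∃ c : ℝ, 0 < c ∧ Integrable (fun x : ℝ => Real.exp (c * |x|)) ν

theorem integrable_exp_abs_of_le {α : Type*} [MeasurableSpace α] {ν : Measure α} {f : α → ℝ}
    (hf : AEMeasurable f ν) {c d : ℝ} (hcd : |d| ≤ c)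
    (h : Integrable (fun x => Real.exp (c * |f x|)) ν) :
    Integrable (fun x => Real.exp (d * f x)) ν := by
  refine h.mono' (by fun_prop) (.of_forall fun x => ?_)
  rw [Real.norm_eq_abs, Real.abs_exp, Real.exp_le_exp]
  calc d * f x ≤ |d * f x| := le_abs_self _
    _ = |d| * |f x| := abs_mul _ _
    _ ≤ c * |f x| := by gcongr

/-- The Taylor series of `cosh` has only even powers and nonnegative coefficients, so Tonelli
applies with no integrability assumption. -/
theorem lintegral_ofReal_cosh (ν : Measure ℝ) (c : ℝ) :
    ∫⁻ x, ENNReal.ofReal (Real.cosh (c * x)) ∂ν =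
      ∑' n : ℕ, ∫⁻ x, ENNReal.ofReal ((c * x) ^ (2 * n) / (2 * n).factorial) ∂ν := by
  rw [← lintegral_tsum fun n => by fun_prop]
  congr 1 with x
  rw [← (Real.hasSum_cosh (c * x)).tsum_eq]
  refine ENNReal.ofReal_tsum_of_nonneg (fun n => ?_) (Real.hasSum_cosh (c * x)).summable
  rw [pow_mul]; positivity

/-- Carries exponential integrability over to a competitor `ν'` about which only the moments are
known. -/
theorem lintegral_ofReal_cosh_congr {ν ν' : Measure ℝ} (c : ℝ)
    (hν : ∀ j : ℕ, Integrable (fun x : ℝ => x ^ j) ν)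
    (hν' : ∀ j : ℕ, Integrable (fun x : ℝ => x ^ j) ν')
    (h : ∀ j : ℕ, ∫ x, x ^ j ∂ν' = ∫ x, x ^ j ∂ν) :
    ∫⁻ x, ENNReal.ofReal (Real.cosh (c * x)) ∂ν' =
      ∫⁻ x, ENNReal.ofReal (Real.cosh (c * x)) ∂ν := by
  rw [lintegral_ofReal_cosh, lintegral_ofReal_cosh]
  congr 1 with n
  have key : ∀ ρ : Measure ℝ, (∀ j : ℕ, Integrable (fun x : ℝ => x ^ j) ρ) →
      ∫⁻ x, ENNReal.ofReal ((c * x) ^ (2 * n) / (2 * n).factorial) ∂ρ =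
        ENNReal.ofReal (c ^ (2 * n) / (2 * n).factorial * ∫ x, x ^ (2 * n) ∂ρ) := by
    intro ρ hρ
    have e : ∀ x : ℝ, (c * x) ^ (2 * n) / (2 * n).factorial =
        c ^ (2 * n) / (2 * n).factorial * x ^ (2 * n) := fun x => by ring
    simp_rw [e]
    rw [← integral_const_mul, ofReal_integral_eq_lintegral_ofReal ((hρ _).const_mul _)]
    refine .of_forall fun x => ?_
    simp only [pow_mul, Pi.zero_apply]; positivity
  rw [key ν' hν', key ν hν, h]

theorem integrable_exp_of_cosh {ν : Measure ℝ} {c t : ℝ} (ht : |t| ≤ c)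
    (h : ∫⁻ x, ENNReal.ofReal (Real.cosh (c * x)) ∂ν ≠ ∞) :
    Integrable (fun x => Real.exp (t * x)) ν := by
  have hc : Integrable (fun x => Real.cosh (c * x)) ν := by
    refine ⟨by fun_prop, ?_⟩
    rw [hasFiniteIntegral_iff_ofReal (.of_forall fun x => (Real.cosh_pos _).le)]
    exact h.lt_top
  have hc0 : 0 ≤ c := (abs_nonneg t).trans ht
  refine integrable_exp_abs_of_le (f := fun x => x) (by fun_prop) ht ?_
  refine (hc.const_mul 2).mono' (by fun_prop) (.of_forall fun x => ?_)
  rw [Real.norm_eq_abs, Real.abs_exp, ← Real.cosh_abs, abs_mul, abs_of_nonneg hc0, Real.cosh_eq]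
  have := Real.exp_pos (-(c * |x|))
  linarith

theorem mem_interior_integrableExpSet {ν : Measure ℝ} {c t : ℝ} (ht : |t| < c)
    (h : ∀ s : ℝ, |s| ≤ c → Integrable (fun x => Real.exp (s * x)) ν) :
    t ∈ interior (integrableExpSet id ν) := by
  rw [mem_interior]
  refine ⟨Set.Ioo (-c) c, fun s hs => h s (abs_le.2 ⟨hs.1.le, hs.2.le⟩), isOpen_Ioo, ?_⟩
  exact abs_lt.1 ht

/-- Both functions are analytic at `0`, and their Taylor coefficients there are given by the
moments. -/
theorem complexMGF_eventuallyEq {ν ν' : Measure ℝ}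
    (hν : (0 : ℝ) ∈ interior (integrableExpSet id ν))
    (hν' : (0 : ℝ) ∈ interior (integrableExpSet id ν'))
    (h : ∀ j : ℕ, ∫ x, x ^ j ∂ν' = ∫ x, x ^ j ∂ν) :
    complexMGF id ν' =ᶠ[𝓝 0] complexMGF id ν := by
  have a := (analyticAt_complexMGF (z := 0) (by simpa using hν)).hasFPowerSeriesAt
  have a' := (analyticAt_complexMGF (z := 0) (by simpa using hν')).hasFPowerSeriesAt
  have e : ∀ n, iteratedDeriv n (complexMGF id ν') 0 = iteratedDeriv n (complexMGF id ν) 0 := by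
    intro n
    rw [iteratedDeriv_complexMGF (by simpa using hν'), iteratedDeriv_complexMGF (by simpa using hν)]
    have := h n
    simp only [id, zero_mul, Complex.exp_zero, mul_one, ← Complex.ofReal_pow]
    rw [integral_complex_ofReal, integral_complex_ofReal, this]
  simp_rw [e] at a'
  filter_upwards [a.eventually_hasSum, a'.eventually_hasSum] with y h1 h2
  simpa using h2.unique h1

/-- A measure with an exponential moment is determined by its moments. -/
theorem HasExpMoment.determinate {ν : Measure ℝ} [IsFiniteMeasure ν] (hν : HasExpMoment ν) :
    Determinate ν := by
  obtain ⟨c, hc, hexp⟩ := hν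
  have hint : ∀ s : ℝ, |s| ≤ c → Integrable (fun x => Real.exp (s * x)) ν := fun s hs =>
    integrable_exp_abs_of_le (f := fun x => x) (by fun_prop) hs hexp
  have h0 : (0 : ℝ) ∈ interior (integrableExpSet id ν) :=
    mem_interior_integrableExpSet (by simpa using hc) hint
  have hmom : ∀ j : ℕ, Integrable (fun x : ℝ => x ^ j) ν := fun j => by
    simpa using integrable_pow_of_mem_interior_integrableExpSet h0 j
  refine ⟨hmom, fun ν' h => ?_⟩
  -- The competitor is an arbitrary measure; integrability of its zeroth power makes it finite.
  have hfin : IsFiniteMeasure ν' := by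
    have := (h 0).1
    simpa [integrable_const_iff] using this
  have hcosh : ∫⁻ x, ENNReal.ofReal (Real.cosh (c * x)) ∂ν' ≠ ∞ := by
    rw [lintegral_ofReal_cosh_congr c hmom (fun j => (h j).1) (fun j => (h j).2)]
    have hi : Integrable (fun x => Real.cosh (c * x)) ν := by
      simp_rw [Real.cosh_eq, ← neg_mul]
      exact ((hint c (abs_of_pos hc).le).add (hint (-c) (by rw [abs_neg, abs_of_pos hc]))).div_const 2
    have := hi.2
    rw [hasFiniteIntegral_iff_ofReal (.of_forall fun x => (Real.cosh_pos _).le)] at this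
    exact this.ne
  have hint' : ∀ s : ℝ, |s| ≤ c → Integrable (fun x => Real.exp (s * x)) ν' := fun s hs =>
    integrable_exp_of_cosh hs hcosh
  have h0' : (0 : ℝ) ∈ interior (integrableExpSet id ν') :=
    mem_interior_integrableExpSet (by simpa using hc) hint'
  -- The identity theorem on this strip extends the local equality at `0` to the imaginary axis,
  -- where the values are the characteristic functions.
  let U : Set ℂ := Complex.re ⁻¹' Set.Ioo (-c) c
  have hU : ∀ ρ : Measure ℝ, (∀ s : ℝ, |s| ≤ c → Integrable (fun x => Real.exp (s * x)) ρ) →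
      AnalyticOnNhd ℂ (complexMGF id ρ) U := fun ρ hρ z hz =>
    analyticAt_complexMGF (mem_interior_integrableExpSet (abs_lt.2 hz) hρ)
  have hconn : IsPreconnected U :=
    ((convex_Ioo (-c) c).linear_preimage Complex.reLm).isPreconnected
  have heq : Set.EqOn (complexMGF id ν') (complexMGF id ν) U :=
    (hU ν' hint').eqOn_of_preconnected_of_eventuallyEq (hU ν hint) hconn (z₀ := 0)
      (by simpa [U] using hc) (complexMGF_eventuallyEq h0 h0' fun j => (h j).2)
  refine Measure.ext_of_charFun (funext fun t => ?_)
  rw [← complexMGF_id_mul_I, ← complexMGF_id_mul_I]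
  exact heq (by simpa [U] using hc)

theorem HasExpMoment.integrable_pow {ν : Measure ℝ} [IsFiniteMeasure ν] (hν : HasExpMoment ν)
    (j : ℕ) : Integrable (fun x : ℝ => x ^ j) ν :=
  hν.determinate.1 j

theorem integrable_mul_of_sq {α : Type*} [MeasurableSpace α] {ν : Measure α} {f g : α → ℝ}
    (hf : AEStronglyMeasurable f ν) (hg : AEStronglyMeasurable g ν)
    (hf2 : Integrable (fun x => f x ^ 2) ν) (hg2 : Integrable (fun x => g x ^ 2) ν) :
    Integrable (fun x => f x * g x) ν := by
  refine (hf2.add hg2).mono' (hf.mul hg) (.of_forall fun x => ?_)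
  rw [Real.norm_eq_abs, abs_le, Pi.add_apply]
  constructor <;> nlinarith [sq_nonneg (f x + g x), sq_nonneg (f x - g x)]

/-- A linear form is bounded by a multiple of `max |x| |y|`, and the exponential of a maximum is at
most the sum of the exponentials. No independence is needed. -/
theorem HasExpMoment.map_linear {ν : Measure (ℝ × ℝ)} [IsFiniteMeasure ν]
    (h1 : HasExpMoment (ν.map Prod.fst)) (h2 : HasExpMoment (ν.map Prod.snd)) (a b : ℝ) :
    HasExpMoment (ν.map fun z => a * z.1 + b * z.2) := by
  obtain ⟨c, hc, hi⟩ := h1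
  obtain ⟨d, hd, hj⟩ := h2
  rw [integrable_map_measure (by fun_prop) (by fun_prop)] at hi hj
  set e := min c d with he
  have he0 : 0 < e := lt_min hc hd
  set s := |a| + |b| + 1 with hs
  have hs0 : 0 < s := by positivity
  refine ⟨e / (2 * s), by positivity, ?_⟩
  rw [integrable_map_measure (by fun_prop) (by fun_prop)]
  refine (hi.add hj).mono' (by fun_prop) (.of_forall fun z => ?_)
  simp only [Function.comp, Pi.add_apply, Real.norm_eq_abs, Real.abs_exp]
  set m := max |z.1| |z.2| with hm
  have hz1 : |z.1| ≤ m := le_max_left _ _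
  have hz2 : |z.2| ≤ m := le_max_right _ _
  have hm0 : 0 ≤ m := (abs_nonneg _).trans hz1
  have hab : |a * z.1 + b * z.2| ≤ s * m := by
    calc |a * z.1 + b * z.2| ≤ |a| * |z.1| + |b| * |z.2| := by
          simpa [abs_mul] using abs_add_le (a * z.1) (b * z.2)
      _ ≤ |a| * m + |b| * m := by gcongr
      _ ≤ s * m := by rw [hs]; linarith
  have hle : e / (2 * s) * |a * z.1 + b * z.2| ≤ e * m := by
    calc e / (2 * s) * |a * z.1 + b * z.2| ≤ e / (2 * s) * (s * m) := by gcongr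
      _ = e * m / 2 := by field_simp
      _ ≤ e * m := half_le_self (by positivity)
  refine (Real.exp_le_exp.2 hle).trans ?_
  rcases max_choice |z.1| |z.2| with h | h
  · have : Real.exp (e * m) ≤ Real.exp (c * |z.1|) := by
      rw [hm, h, Real.exp_le_exp]; gcongr; exact min_le_left _ _
    linarith [Real.exp_pos (d * |z.2|)]
  · have : Real.exp (e * m) ≤ Real.exp (d * |z.2|) := by
      rw [hm, h, Real.exp_le_exp]; gcongr; exact min_le_right _ _
    linarith [Real.exp_pos (c * |z.1|)]

theorem integrable_linear_pow {ν : Measure (ℝ × ℝ)}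
    (h : ∀ i j : ℕ, Integrable (fun z : ℝ × ℝ => z.1 ^ i * z.2 ^ j) ν) (a b : ℝ) (n k : ℕ) :
    Integrable (fun z : ℝ × ℝ => (a * z.1) ^ k * (b * z.2) ^ (n - k) * (n.choose k : ℝ)) ν := by
  have := (h k (n - k)).const_mul (a ^ k * b ^ (n - k) * (n.choose k : ℝ))
  refine this.congr (.of_forall fun z => ?_)
  simp only; ring

theorem integral_linear_pow {ν : Measure (ℝ × ℝ)}
    (h : ∀ i j : ℕ, Integrable (fun z : ℝ × ℝ => z.1 ^ i * z.2 ^ j) ν) (a b : ℝ) (n : ℕ) :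
    ∫ z, (a * z.1 + b * z.2) ^ n ∂ν = ∑ k ∈ Finset.range (n + 1),
      a ^ k * b ^ (n - k) * (n.choose k : ℝ) * ∫ z, z.1 ^ k * z.2 ^ (n - k) ∂ν := by
  simp_rw [add_pow]
  rw [integral_finsetSum _ fun k _ => integrable_linear_pow h a b n k]
  refine Finset.sum_congr rfl fun k _ => ?_
  rw [← integral_const_mul]
  congr 1 with z
  ring

/-- A planar measure whose marginals have exponential moments is determined by its moments. -/
theorem determinate₂_of_hasExpMoment {ν : Measure (ℝ × ℝ)} [IsFiniteMeasure ν]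
    (h1 : HasExpMoment (ν.map Prod.fst)) (h2 : HasExpMoment (ν.map Prod.snd)) :
    Determinate₂ ν := by
  have hmom : ∀ i j : ℕ, Integrable (fun z : ℝ × ℝ => z.1 ^ i * z.2 ^ j) ν := by
    intro i j
    -- Squaring the factors reduces mixed moments to even moments of the marginals.
    refine integrable_mul_of_sq (by fun_prop) (by fun_prop) ?_ ?_
    · have := h1.integrable_pow (i * 2)
      rw [integrable_map_measure (by fun_prop) (by fun_prop)] at this
      simpa [Function.comp_def, pow_mul] using this
    · have := h2.integrable_pow (j * 2)
      rw [integrable_map_measure (by fun_prop) (by fun_prop)] at this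
      simpa [Function.comp_def, pow_mul] using this
  refine ⟨hmom, fun ν' h => ?_⟩
  have hfin : IsFiniteMeasure ν' := by
    have := (h 0 0).1
    simpa [integrable_const_iff] using this
  -- Cramér–Wold: by the binomial formula the planar moments fix the moments of every linear image,
  -- and each image is determinate on the line.
  have hmap : ∀ a b : ℝ, ν'.map (fun z => a * z.1 + b * z.2) =
      ν.map (fun z => a * z.1 + b * z.2) := by
    intro a b
    refine (h1.map_linear h2 a b).determinate.2 _ fun n => ⟨?_, ?_⟩
    · rw [integrable_map_measure (by fun_prop) (by fun_prop)]
      simp only [Function.comp_def, add_pow]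
      exact integrable_finsetSum _ fun k _ =>
        integrable_linear_pow (fun i j => (h i j).1) a b n k
    · rw [integral_map (by fun_prop) (by fun_prop), integral_map (by fun_prop) (by fun_prop),
        integral_linear_pow (fun i j => (h i j).1), integral_linear_pow hmom]
      simp_rw [fun i j => (h i j).2]
  refine Measure.ext_of_charFunDual (funext fun L => ?_)
  have hL : (L : ℝ × ℝ → ℝ) = fun z => L (1, 0) * z.1 + L (0, 1) * z.2 := by
    ext z
    conv_lhs => rw [show z = z.1 • ((1 : ℝ), (0 : ℝ)) + z.2 • ((0 : ℝ), (1 : ℝ)) by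
      ext <;> simp]
    rw [map_add, map_smul, map_smul, smul_eq_mul, smul_eq_mul]
    ring
  rw [charFunDual_eq_charFun_map_one, charFunDual_eq_charFun_map_one, hL, hmap]

/-! ### Gaussian mixtures as images of a product measure -/

theorem normal_eq_map (p : ℝ × ℝ) :
    normal p = (gaussianReal 0 1).map (fun z => p.2 * z + p.1) := by
  have e : (gaussianReal 0 1).map (fun z => p.2 * z + p.1) =
      ((gaussianReal 0 1).map (fun z => p.2 * z)).map (fun z => z + p.1) := by
    rw [Measure.map_map (by fun_prop) (by fun_prop)]; rfl
  rw [e, gaussianReal_map_const_mul, gaussianReal_map_add_const, normal]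
  congr 1
  · simp
  · ext; simp [sq_nonneg]

/-- The map `((m, σ), z) ↦ σ z + m`. -/
def affineMap (S : Set (ℝ × ℝ)) (q : S × ℝ) : ℝ := q.1.1.2 * q.2 + q.1.1.1

theorem continuous_affineMap (S : Set (ℝ × ℝ)) : Continuous (affineMap S) := by
  unfold affineMap; fun_prop

variable {S : Set (ℝ × ℝ)}

/-- The mixture is the law of `σ Z + m` with `Z` standard normal and independent of `(m, σ)`. Weak
continuity in `φ`, exponential bounds and moments are all read off this form. -/
theorem mixture_eq_map (φ : ProbabilityMeasure S) :
    mixture φ = ((φ : Measure S).prod (gaussianReal 0 1)).map (affineMap S) := by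
  have hm : Measurable (affineMap S) := (continuous_affineMap S).measurable
  ext B hB
  rw [mixture_apply φ hB, Measure.map_apply hm hB, Measure.prod_apply (hm hB)]
  congr 1 with p
  rw [normal_eq_map, Measure.map_apply (by fun_prop) hB]
  rfl

/-- The Gaussian mixture as a bundled probability measure. -/
noncomputable def mixtureProb (φ : ProbabilityMeasure S) : ProbabilityMeasure ℝ :=
  ⟨mixture φ, inferInstance⟩

theorem continuous_mixtureProb : Continuous (mixtureProb (S := S)) := by
  have h : (mixtureProb (S := S)) = fun φ : ProbabilityMeasure S =>
      (φ.prod (⟨gaussianReal 0 1, inferInstance⟩ : ProbabilityMeasure ℝ)).map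
        (continuous_affineMap S).aemeasurable := by
    ext1 φ
    apply Subtype.ext
    exact mixture_eq_map φ
  rw [h]
  exact (ProbabilityMeasure.continuous_map (continuous_affineMap S)).comp
    (ProbabilityMeasure.continuous_prod.comp (continuous_id.prodMk continuous_const))

/-- With `|m|, |σ| ≤ r` on `S`, `|σ z + m| ≤ r + r |z|`, and a Gaussian has all exponential moments.
-/
theorem hasExpMoment_mixture (hS : IsCompact S) (φ : ProbabilityMeasure S) :
    HasExpMoment (mixture φ) := by
  obtain ⟨R, hR⟩ := hS.isBounded.exists_norm_le
  set r := max R 1 with hr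
  have hr0 : 0 < r := lt_max_of_lt_right one_pos
  have hbound : ∀ p : S, |p.1.1| ≤ r ∧ |p.1.2| ≤ r := fun p =>
    ⟨((norm_fst_le p.1).trans (hR _ p.2)).trans (le_max_left _ _),
      ((norm_snd_le p.1).trans (hR _ p.2)).trans (le_max_left _ _)⟩
  have hm : Measurable (affineMap S) := (continuous_affineMap S).measurable
  refine ⟨1, one_pos, ?_⟩
  rw [mixture_eq_map, integrable_map_measure (by fun_prop) hm.aemeasurable]
  have hg : Integrable (fun z : ℝ => Real.exp (r * |z|)) (gaussianReal 0 1) :=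
    integrable_exp_mul_abs (integrable_exp_mul_gaussianReal r)
      (integrable_exp_mul_gaussianReal (-r))
  refine (Integrable.mul_prod (μ := (φ : Measure S)) (ν := gaussianReal 0 1)
    (integrable_const (Real.exp r)) hg).mono' (by fun_prop) (.of_forall fun q => ?_)
  simp only [Function.comp, Real.norm_eq_abs, Real.abs_exp, one_mul]
  rw [← Real.exp_add, Real.exp_le_exp, affineMap]
  obtain ⟨h1, h2⟩ := hbound q.1
  calc |q.1.1.2 * q.2 + q.1.1.1| ≤ |q.1.1.2| * |q.2| + |q.1.1.1| := by
        simpa [abs_mul] using abs_add_le (q.1.1.2 * q.2) q.1.1.1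
    _ ≤ r * |q.2| + r := by gcongr
    _ = r + r * |q.2| := add_comm _ _

theorem integral_pow_mixture (hS : IsCompact S) (φ : ProbabilityMeasure S) (j : ℕ) :
    ∫ y, y ^ j ∂mixture φ =
      ∫ p, MvPolynomial.eval ![p.1.1, p.1.2] (momentPoly j) ∂(φ : Measure S) := by
  have hm : Measurable (affineMap S) := (continuous_affineMap S).measurable
  have hint := (hasExpMoment_mixture hS φ).integrable_pow j
  rw [mixture_eq_map, integrable_map_measure (by fun_prop) hm.aemeasurable] at hint
  rw [mixture_eq_map, integral_map hm.aemeasurable (by fun_prop)]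
  refine (integral_prod _ hint).trans ?_
  congr 1 with p
  rw [eval_momentPoly, normal_eq_map, integral_map (by fun_prop) (by fun_prop)]
  rfl

/-! ### Couplings and costs -/

theorem IsCoupling.integrable_fst {μ ν : Measure ℝ} {lam : ProbabilityMeasure (ℝ × ℝ)}
    (h : IsCoupling μ ν lam) {f : ℝ → ℝ} (hf : Integrable f μ) :
    Integrable (fun z : ℝ × ℝ => f z.1) (lam : Measure (ℝ × ℝ)) := by
  rw [← h.1] at hf
  exact hf.comp_aemeasurable (by fun_prop)

theorem IsCoupling.integrable_snd {μ ν : Measure ℝ} {lam : ProbabilityMeasure (ℝ × ℝ)}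
    (h : IsCoupling μ ν lam) {f : ℝ → ℝ} (hf : Integrable f ν) :
    Integrable (fun z : ℝ × ℝ => f z.2) (lam : Measure (ℝ × ℝ)) := by
  rw [← h.2] at hf
  exact hf.comp_aemeasurable (by fun_prop)

theorem IsCoupling.cost_ne_top {μ ν : Measure ℝ} {lam : ProbabilityMeasure (ℝ × ℝ)}
    (h : IsCoupling μ ν lam) (hμ : Integrable (fun x : ℝ => x ^ 2) μ)
    (hν : Integrable (fun x : ℝ => x ^ 2) ν) : cost lam ≠ ∞ := by
  have hi : Integrable (fun z : ℝ × ℝ => (z.1 - z.2) ^ 2) (lam : Measure (ℝ × ℝ)) := by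
    refine (((h.integrable_fst hμ).add (h.integrable_snd hν)).const_mul 2).mono'
      (by fun_prop) (.of_forall fun z => ?_)
    rw [Real.norm_eq_abs, abs_of_nonneg (sq_nonneg _), Pi.add_apply]
    nlinarith [sq_nonneg (z.1 + z.2)]
  have := hi.2
  rw [hasFiniteIntegral_iff_ofReal (.of_forall fun z => sq_nonneg _)] at this
  exact this.ne

/-- The independent coupling. -/
theorem exists_isCoupling (μ ν : Measure ℝ) [IsProbabilityMeasure μ] [IsProbabilityMeasure ν] :
    ∃ lam, IsCoupling μ ν lam :=
  ⟨⟨μ.prod ν, inferInstance⟩, by simp [IsCoupling]⟩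

theorem W2_sq (μ ν : Measure ℝ) :
    W2 μ ν ^ 2 = ⨅ (lam : ProbabilityMeasure (ℝ × ℝ)) (_ : IsCoupling μ ν lam), cost lam := by
  rw [W2, ← ENNReal.rpow_natCast, ← ENNReal.rpow_mul]
  norm_num

theorem tau_le_cost {μ : Measure ℝ} {φ : ProbabilityMeasure S} {lam : ProbabilityMeasure (ℝ × ℝ)}
    (h : FeasibleOT μ φ lam) : tau μ S ≤ cost lam :=
  (iInf_le _ φ).trans (by rw [W2_sq]; exact iInf₂_le lam h)

theorem OptimalOT.W2_sq_eq {μ : Measure ℝ} {φ : ProbabilityMeasure S}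
    {lam : ProbabilityMeasure (ℝ × ℝ)} (h : OptimalOT μ φ lam) :
    W2 μ (mixture φ) ^ 2 = cost lam := by
  rw [W2_sq]
  exact le_antisymm (iInf₂_le lam h.1) (le_iInf₂ fun lam' h' => h.2 φ lam' h')

theorem OptimalOT.cost_eq_tau {μ : Measure ℝ} {φ : ProbabilityMeasure S}
    {lam : ProbabilityMeasure (ℝ × ℝ)} (h : OptimalOT μ φ lam) : cost lam = tau μ S := by
  refine le_antisymm (le_iInf fun φ' => ?_) (tau_le_cost h.1)
  rw [W2_sq]
  exact le_iInf₂ fun lam' h' => h.2 φ' lam' h'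

theorem cost_eq_zero_iff (lam : ProbabilityMeasure (ℝ × ℝ)) :
    cost lam = 0 ↔ ∀ᵐ z ∂(lam : Measure (ℝ × ℝ)), z.1 = z.2 := by
  rw [cost, lintegral_eq_zero_iff (by fun_prop)]
  refine Filter.eventually_congr (.of_forall fun z => ?_)
  rw [Pi.zero_apply, ENNReal.ofReal_eq_zero]
  constructor
  · intro h
    have := pow_eq_zero_iff (two_ne_zero) |>.1 (le_antisymm h (sq_nonneg _))
    linarith
  · intro h; simp [h]

/-- Zero cost means `x = y` almost everywhere, so the identity agrees a.e. with `z ↦ (z.1, z.1)` and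
the two projections agree a.e. -/
theorem IsCoupling.diagonal_of_cost_eq_zero {μ ν : Measure ℝ} {lam : ProbabilityMeasure (ℝ × ℝ)}
    (h : IsCoupling μ ν lam) (h0 : cost lam = 0) :
    (lam : Measure (ℝ × ℝ)) = μ.map (fun x => (x, x)) ∧ μ = ν := by
  have hd := (cost_eq_zero_iff lam).1 h0
  constructor
  · rw [← h.1, Measure.map_map (by fun_prop) (by fun_prop)]
    conv_lhs => rw [← Measure.map_id (μ := (lam : Measure (ℝ × ℝ)))]
    refine Measure.map_congr ?_
    filter_upwards [hd] with z hz
    exact Prod.ext rfl hz.symm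
  · rw [← h.1, ← h.2]
    exact Measure.map_congr hd

theorem exists_isCoupling_self (μ : Measure ℝ) [IsProbabilityMeasure μ] :
    ∃ lam, IsCoupling μ μ lam ∧ cost lam = 0 := by
  refine ⟨⟨μ.map (fun x => (x, x)), Measure.isProbabilityMeasure_map (by fun_prop)⟩,
    ⟨?_, ?_⟩, ?_⟩
  · simp only [ProbabilityMeasure.coe_mk]
    rw [Measure.map_map (by fun_prop) (by fun_prop)]
    exact Measure.map_id
  · simp only [ProbabilityMeasure.coe_mk]
    rw [Measure.map_map (by fun_prop) (by fun_prop)]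
    exact Measure.map_id
  · simp only [cost, ProbabilityMeasure.coe_mk]
    rw [lintegral_map (by fun_prop) (by fun_prop)]
    simp

theorem tau_eq_zero_of_eq_mixture {μ : Measure ℝ} [IsProbabilityMeasure μ]
    {φ : ProbabilityMeasure S} (h : μ = mixture φ) : tau μ S = 0 := by
  obtain ⟨lam, hlam, h0⟩ := exists_isCoupling_self μ
  refine le_antisymm (h0 ▸ tau_le_cost (φ := φ) ?_) bot_le
  rwa [FeasibleOT, ← h]

/-! ### The two feasibility notions agree -/

/-- Only determinacy of the two target marginals `μ` and `ν_φ` is used; nothing is required of `lam`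
itself. -/
theorem feasibleMoment_iff_feasibleOT (hS : IsCompact S) {μ : Measure ℝ} [IsFiniteMeasure μ]
    (hμ : HasExpMoment μ) (φ : ProbabilityMeasure S) (lam : ProbabilityMeasure (ℝ × ℝ)) :
    FeasibleMoment μ φ lam ↔ FeasibleOT μ φ lam := by
  have hν := hasExpMoment_mixture hS φ
  constructor
  · intro h
    constructor
    · refine hμ.determinate.2 _ fun j => ⟨?_, ?_⟩
      · rw [integrable_map_measure (by fun_prop) (by fun_prop)]
        exact (h j).1.1
      · rw [integral_map (by fun_prop) (by fun_prop)]
        exact (h j).1.2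
    · refine hν.determinate.2 _ fun j => ⟨?_, ?_⟩
      · rw [integrable_map_measure (by fun_prop) (by fun_prop)]
        exact (h j).2.1
      · rw [integral_map (by fun_prop) (by fun_prop), integral_pow_mixture hS]
        exact (h j).2.2
  · intro h j
    refine ⟨⟨h.integrable_fst (hμ.integrable_pow j), ?_⟩,
      ⟨h.integrable_snd (hν.integrable_pow j), ?_⟩⟩
    · rw [← h.1, integral_map (by fun_prop) (by fun_prop)]
    · rw [← integral_pow_mixture hS, ← h.2, integral_map (by fun_prop) (by fun_prop)]

theorem optimalMoment_of_optimalOT (hS : IsCompact S) {μ : Measure ℝ} [IsFiniteMeasure μ]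
    (hμ : HasExpMoment μ) {φ : ProbabilityMeasure S} {lam : ProbabilityMeasure (ℝ × ℝ)}
    (h : OptimalOT μ φ lam) : OptimalMoment μ φ lam :=
  ⟨(feasibleMoment_iff_feasibleOT hS hμ φ lam).2 h.1, fun φ' lam' h' =>
    h.2 φ' lam' ((feasibleMoment_iff_feasibleOT hS hμ φ' lam').1 h')⟩

/-! ### Existence of an optimal solution -/

/-- By monotone convergence the cost is the supremum over `n` of the integrals of `min ((x - y)²,
n)`, each weakly continuous in `lam`. -/
theorem lowerSemicontinuous_cost : LowerSemicontinuous cost := by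
  let f : ℕ → BoundedContinuousFunction (ℝ × ℝ) NNReal := fun n =>
    BoundedContinuousFunction.mkOfBound
      ⟨fun z => min ((z.1 - z.2) ^ 2).toNNReal n, by fun_prop⟩ n (fun z w => by
        simp only [ContinuousMap.coe_mk]
        rw [NNReal.dist_eq, abs_le]
        have h1 : ((min ((z.1 - z.2) ^ 2).toNNReal (n : NNReal) : NNReal) : ℝ) ≤ n := by
          exact_mod_cast min_le_right _ _
        have h2 : ((min ((w.1 - w.2) ^ 2).toNNReal (n : NNReal) : NNReal) : ℝ) ≤ n := by
          exact_mod_cast min_le_right _ _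
        constructor <;> linarith [NNReal.coe_nonneg (min ((z.1 - z.2) ^ 2).toNNReal (n : NNReal)),
          NNReal.coe_nonneg (min ((w.1 - w.2) ^ 2).toNNReal (n : NNReal))])
  have hf : cost = fun lam : ProbabilityMeasure (ℝ × ℝ) =>
      ⨆ n, ∫⁻ z, (f n z : ℝ≥0∞) ∂(lam : Measure (ℝ × ℝ)) := by
    ext1 lam
    rw [← lintegral_iSup (fun n => by fun_prop)]
    · rw [cost]
      congr 1 with z
      obtain ⟨k, hk⟩ := exists_nat_ge ((z.1 - z.2) ^ 2).toNNReal
      refine le_antisymm (le_iSup_of_le k ?_) (iSup_le fun n => ?_)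
      · exact ENNReal.coe_le_coe.2 (le_min le_rfl hk)
      · exact ENNReal.coe_le_coe.2 (min_le_left _ _)
    · intro n k hnk z
      exact ENNReal.coe_le_coe.2 (min_le_min le_rfl (by exact_mod_cast hnk))
  rw [hf]
  exact lowerSemicontinuous_iSup fun n =>
    (ProbabilityMeasure.continuous_lintegral_boundedContinuousFunction (f n)).lowerSemicontinuous

theorem isClosed_feasibleOT (μ : Measure ℝ) [IsProbabilityMeasure μ] :
    IsClosed {q : ProbabilityMeasure S × ProbabilityMeasure (ℝ × ℝ) | FeasibleOT μ q.1 q.2} := by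
  have h : {q : ProbabilityMeasure S × ProbabilityMeasure (ℝ × ℝ) | FeasibleOT μ q.1 q.2} =
      {q | q.2.map (continuous_fst (X := ℝ) (Y := ℝ)).aemeasurable =
        (⟨μ, inferInstance⟩ : ProbabilityMeasure ℝ)} ∩
      {q | q.2.map (continuous_snd (X := ℝ) (Y := ℝ)).aemeasurable = mixtureProb q.1} := by
    ext q
    exact ⟨fun hq => ⟨Subtype.ext hq.1, Subtype.ext hq.2⟩,
      fun hq => ⟨congrArg Subtype.val hq.1, congrArg Subtype.val hq.2⟩⟩
  rw [h]
  exact (isClosed_eq ((ProbabilityMeasure.continuous_map continuous_fst).comp continuous_snd)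
    continuous_const).inter
    (isClosed_eq ((ProbabilityMeasure.continuous_map continuous_snd).comp continuous_snd)
      (continuous_mixtureProb.comp continuous_fst))

theorem isCompact_feasibleOT (hS : IsCompact S) (μ : Measure ℝ) [IsProbabilityMeasure μ] :
    IsCompact {q : ProbabilityMeasure S × ProbabilityMeasure (ℝ × ℝ) | FeasibleOT μ q.1 q.2} := by
  have : CompactSpace S := isCompact_iff_compactSpace.1 hS
  let T : Set (ProbabilityMeasure (ℝ × ℝ)) := {lam | ∃ φ : ProbabilityMeasure S, FeasibleOT μ φ lam}
  -- The mixtures are a continuous image of the compact space `ProbabilityMeasure S`; the converse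
  -- half of Prokhorov's theorem makes them tight.
  have hmix : IsTightMeasureSet
      {x | ∃ ν ∈ Set.range (mixtureProb (S := S)), (ν : Measure ℝ) = x} := by
    refine isTightMeasureSet_of_isCompact_closure ?_
    rw [(isCompact_range continuous_mixtureProb).isClosed.closure_eq]
    exact isCompact_range continuous_mixtureProb
  have hT : IsTightMeasureSet {x | ∃ lam ∈ T, (lam : Measure (ℝ × ℝ)) = x} := by
    -- Tightness of both families of marginals gives tightness of the couplings.
    refine IsTightMeasureSet.prodMk
      ((isTightMeasureSet_singleton (μ := μ)).subset ?_) (hmix.subset ?_)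
    · rintro _ ⟨_, ⟨lam, ⟨φ, h⟩, rfl⟩, rfl⟩
      exact h.1
    · rintro _ ⟨_, ⟨lam, ⟨φ, h⟩, rfl⟩, rfl⟩
      exact ⟨mixtureProb φ, ⟨φ, rfl⟩, h.2.symm⟩
  refine (isCompact_univ.prod (isCompact_closure_of_isTightMeasureSet hT)).of_isClosed_subset
    (isClosed_feasibleOT μ) ?_
  rintro ⟨φ, lam⟩ h
  exact ⟨Set.mem_univ _, subset_closure ⟨φ, h⟩⟩

theorem exists_feasibleOT (hS : S.Nonempty) (μ : Measure ℝ) [IsProbabilityMeasure μ] :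
    ∃ (φ : ProbabilityMeasure S) (lam : ProbabilityMeasure (ℝ × ℝ)), FeasibleOT μ φ lam := by
  obtain ⟨p, hp⟩ := hS
  let φ : ProbabilityMeasure S := ⟨Measure.dirac ⟨p, hp⟩, inferInstance⟩
  obtain ⟨lam, h⟩ := exists_isCoupling μ (mixture φ)
  exact ⟨φ, lam, h⟩

theorem exists_optimalOT (hS : IsCompact S) (hne : S.Nonempty) (μ : Measure ℝ)
    [IsProbabilityMeasure μ] :
    ∃ (φ : ProbabilityMeasure S) (lam : ProbabilityMeasure (ℝ × ℝ)), OptimalOT μ φ lam := by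
  obtain ⟨φ₀, lam₀, h₀⟩ := exists_feasibleOT hne μ
  obtain ⟨⟨φ, lam⟩, hq, hmin⟩ := LowerSemicontinuousOn.exists_isMinOn
    (f := fun q : ProbabilityMeasure S × ProbabilityMeasure (ℝ × ℝ) => cost q.2)
    ⟨(φ₀, lam₀), h₀⟩ (isCompact_feasibleOT hS μ)
    ((lowerSemicontinuous_cost.comp continuous_snd).lowerSemicontinuousOn _)
  exact ⟨φ, lam, hq, fun φ' lam' h' => hmin (a := (φ', lam')) h'⟩

end GaussMix

theorem theorem3p1
    (S : Set (ℝ × ℝ)) (hSc : IsCompact S) (hSne : S.Nonempty) (hSpos : ∀ p ∈ S, 0 ≤ p.2)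
    (μ : Measure ℝ) [IsProbabilityMeasure μ]
    (hμ : ∃ c : ℝ, 0 < c ∧ Integrable (fun x : ℝ => Real.exp (c * |x|)) μ) :
    tau μ S ≠ ∞ ∧
    (∃ (φ : ProbabilityMeasure S) (lam : ProbabilityMeasure (ℝ × ℝ)),
      OptimalOT μ φ lam ∧ cost lam = tau μ S ∧ W2 μ (mixture φ) ^ 2 = tau μ S ∧
      OptimalMoment μ φ lam ∧
      Determinate₂ (lam : Measure (ℝ × ℝ)) ∧ Determinate (mixture φ)) ∧
    (∀ (φ : ProbabilityMeasure S) (lam : ProbabilityMeasure (ℝ × ℝ)), OptimalOT μ φ lam →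
      (tau μ S = 0 ↔
        (lam : Measure (ℝ × ℝ)) = μ.map (fun x => (x, x)) ∧ μ = mixture φ) ∧
      (tau μ S = 0 ↔ μ = mixture φ)) ∧
    (tau μ S = 0 ↔ ∃ φ : ProbabilityMeasure S, μ = mixture φ) := by
  have hexp : HasExpMoment μ := hμ
  obtain ⟨φ₀, lam₀, h₀⟩ := exists_optimalOT hSc hSne μ
  have hν := hasExpMoment_mixture hSc φ₀
  have hdiag : ∀ {φ : ProbabilityMeasure S} {lam : ProbabilityMeasure (ℝ × ℝ)},
      OptimalOT μ φ lam → tau μ S = 0 →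
        (lam : Measure (ℝ × ℝ)) = μ.map (fun x => (x, x)) ∧ μ = mixture φ := fun h h0 =>
    IsCoupling.diagonal_of_cost_eq_zero h.1 (h.cost_eq_tau.trans h0)
  refine ⟨?_, ⟨φ₀, lam₀, h₀, h₀.cost_eq_tau, h₀.W2_sq_eq.trans h₀.cost_eq_tau,
    optimalMoment_of_optimalOT hSc hexp h₀, ?_, hν.determinate⟩, fun φ lam h => ⟨⟨hdiag h, fun e =>
    tau_eq_zero_of_eq_mixture e.2⟩, ⟨fun h0 => (hdiag h h0).2, tau_eq_zero_of_eq_mixture⟩⟩,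
    ⟨fun h0 => ⟨φ₀, (hdiag h₀ h0).2⟩, fun ⟨φ, e⟩ => tau_eq_zero_of_eq_mixture e⟩⟩
  · rw [← h₀.cost_eq_tau]
    exact IsCoupling.cost_ne_top h₀.1 (hexp.integrable_pow 2) (hν.integrable_pow 2)
  · exact determinate₂_of_hasExpMoment (by rw [h₀.1.1]; exact hexp) (by rw [h₀.1.2]; exact hν)
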